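/- A polygon is the (unrooted, unoriented) edge set of a cycle in the simple cubic lattice $\mathbb Z^3$ (vertices $(x,y,z)\in\mathbb Z^3$, edges between vertices at distance one). Let $\mathcal P$ be the set of polygons all of whose vertices satisfy $x\ge 0$ and which contain at least one edge in the plane $x=0$. The span of such a polygon is the largest $x$-coordinate of its vertices. Let $p_n(s)$ be the number of polygons in $\mathcal P$ with $n$ edges and span $s$, counted up to translations in the $y$- and $z$-directions, and for $f\in\mathbb R$ put \[ Z_n(f)=\sum_{s\ge 0}p_n(s)\,e^{fs}. \] Then the free energy \[ \mathcal F(f)=\lim_{n\to\infty,\ n\text{ even}}\frac1n\log Z_n(f) \] exists as a real number for every $f\in\mathbb R$, and \[ \lim_{f\to\infty}\Bigl(\mathcal F(f)-\frac f2\Bigr)=0 . \] -/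

import Mathlib

/-- A site of the cubic lattice `ℤ³`; coordinates `0, 1, 2` are called `x, y, z`. -/
abbrev Site : Type := Fin 3 → ℤ

/-- The simple cubic lattice: two sites are adjacent when they are at (Euclidean) distance one. -/
def cubicLattice : SimpleGraph Site where
  Adj u v := ∑ i, |u i - v i| = 1
  symm := ⟨fun u v h => by simpa only [abs_sub_comm] using h⟩
  loopless := ⟨fun u h => by simp at h⟩

/-- A self-avoiding polygon, as an unrooted and unoriented object: the (finite) edge set of a cycle
of the cubic lattice. -/
def IsPolygon (E : Finset (Sym2 Site)) : Prop :=
  ∃ (v : Site) (c : cubicLattice.Walk v v), c.IsCycle ∧ ∀ e, e ∈ E ↔ e ∈ c.edges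

/-- The sites occupied by a set of edges. -/
def occupiedSites (E : Finset (Sym2 Site)) : Set Site :=
  {v | ∃ e ∈ E, v ∈ e}

/-- The polygons with `n` edges in the half-space `x ≥ 0` which contain at least one edge in the
plane `x = 0` and have span `s`, that is, `s` is the largest `x`-coordinate of their sites. -/
def halfSpacePolygons (n s : ℕ) : Set (Finset (Sym2 Site)) :=
  {E | IsPolygon E ∧ E.card = n ∧
    (∀ v ∈ occupiedSites E, 0 ≤ v 0) ∧
    (∃ e ∈ E, ∀ v ∈ e, v 0 = 0) ∧
    IsGreatest ((fun v : Site => v 0) '' occupiedSites E) (s : ℤ)}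

/-- The translate of a set of edges by `a` in the `y`-direction and `b` in the `z`-direction. -/
def translateYZ (a b : ℤ) (E : Finset (Sym2 Site)) : Finset (Sym2 Site) :=
  E.image (Sym2.map fun v => v + ![0, a, b])

theorem translateYZ_zero (E : Finset (Sym2 Site)) : translateYZ 0 0 E = E := by
  have h : (fun v : Site => v + ![0, 0, 0]) = id := by
    funext v i
    fin_cases i <;> exact add_zero _
  rw [translateYZ, h, Sym2.map_id, Finset.image_id]

theorem translateYZ_translateYZ (a b a' b' : ℤ) (E : Finset (Sym2 Site)) :
    translateYZ a' b' (translateYZ a b E) = translateYZ (a + a') (b + b') E := by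
  have h : ((fun v : Site => v + ![0, a', b']) ∘ fun v : Site => v + ![0, a, b]) =
      fun v : Site => v + ![0, a + a', b + b'] := by
    funext v i
    fin_cases i
    · exact (add_assoc _ _ _).trans (congrArg _ (add_zero _))
    · exact add_assoc _ _ _
    · exact add_assoc _ _ _
  rw [translateYZ, translateYZ, Finset.image_image, ← Sym2.map_comp, h, translateYZ]

/-- Equality of half-space polygons up to translations in the `y`- and `z`-directions. -/
def polygonSetoid (n s : ℕ) : Setoid (halfSpacePolygons n s) where
  r E E' := ∃ a b : ℤ, E'.1 = translateYZ a b E.1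
  iseqv :=
    { refl := fun E => ⟨0, 0, (translateYZ_zero E.1).symm⟩
      symm := by
        rintro E E' ⟨a, b, h⟩
        refine ⟨-a, -b, ?_⟩
        rw [h, translateYZ_translateYZ, add_neg_cancel, add_neg_cancel, translateYZ_zero]
      trans := by
        rintro E E' E'' ⟨a, b, h⟩ ⟨a', b', h'⟩
        exact ⟨a + a', b + b', by rw [h', h, translateYZ_translateYZ]⟩ }

/-- `p_n(s)`: the number of half-space polygons with `n` edges and span `s`, counted up to
translations in the `y`- and `z`-directions. -/
noncomputable def polygonCount (n s : ℕ) : ℕ :=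
  Nat.card (Quotient (polygonSetoid n s))

/-- The partition function `Z_n(f) = ∑_{s ≥ 0} p_n(s) e^{f s}`; only finitely many terms are
nonzero, as `p_n(s) = 0` for `s ≥ n`. -/
noncomputable def partitionFunction (n : ℕ) (f : ℝ) : ℝ :=
  ∑' s : ℕ, (polygonCount n s : ℝ) * Real.exp (f * s)

/-- `F` is the free energy: for every force `f`, the numbers `(1/n) log Z_n(f)` converge to the real
number `F f` as `n → ∞` through the even integers `n = 2 m`. -/
def IsFreeEnergy (F : ℝ → ℝ) : Prop :=
  ∀ f : ℝ, Filter.Tendsto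
    (fun m : ℕ => (1 / ((2 * m : ℕ) : ℝ)) * Real.log (partitionFunction (2 * m) f))
    Filter.atTop (nhds (F f))

/-! Existence of the limit comes from supermultiplicativity. An edge of one polygon in its top plane
and an edge of another in its bottom plane become parallel and facing after a translation and, if
need be, the exchange of `y` and `z`. Trading these two edges for two `x`-edges joins the polygons:
edge numbers add, and the new span is `s₁ + s₂ + 1`. Once the two edge numbers and the exchange bit
are known, both translation classes can be read off from the class of the result. Hence `Z_m Z_n e^f
≤ 2 Z_{m+n}` (`partitionFunction_mul_le`), and Fekete's lemma applies.

For the asymptotics, polygons with `2m` edges and span `m - 1` exist (`nonempty_halfSpacePolygons`),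
which gives `F(f) ≥ f/2`. Conversely, a polygon of span `s` traversed from a site in `x = 0` makes
at least `2s` steps in the `x`-direction. For `f ≥ 0` and `a = e^{f/2}`, `Z_n` is therefore bounded
by a sum of `a ^ (number of x-steps)` over words without immediate reversals. Such a word can follow
an `x`-step by only one `x`-step, so the growth rate is at most `a + 8`, with leading coefficient 1
(`sum_wordsAfter_le`). Thus `f/2 ≤ F(f) ≤ log (e^{f/2} + 8)`, and the two bounds differ by `log (1 +
8 e^{-f/2})`, which tends to 0. -/

/-! ### Polygons as paths closed by an edge; extremal sites -/

/-- The cycle runs through the edge in one of its two directions. The pieces after and before it,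
glued in this order at the base point, form the path; the other direction is handled by reversal. -/
theorem SimpleGraph.Walk.IsCycle.exists_isPath_of_mem_edges {V : Type*} {G : SimpleGraph V}
    {v u w : V} {c : G.Walk v v} (hc : c.IsCycle) (he : s(u, w) ∈ c.edges) :
    ∃ p : G.Walk w u, p.IsPath ∧ s(u, w) ∉ p.edges ∧
      ∀ e, e ∈ c.edges ↔ e = s(u, w) ∨ e ∈ p.edges := by
  have key : ∀ {u w : V} (h : G.Adj u w), h.toWalk.IsSubwalk c →
      ∃ p : G.Walk w u, p.IsPath ∧ s(u, w) ∉ p.edges ∧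
      ∀ e, e ∈ c.edges ↔ e = s(u, w) ∨ e ∈ p.edges := by
    rintro u w h ⟨ru, rv, rfl⟩
    refine ⟨rv.append ru, ?_, ?_, ?_⟩
    · have h1 := hc.support_nodup
      rw [← SimpleGraph.Walk.append_assoc, SimpleGraph.Walk.support_append,
        List.tail_append_of_ne_nil (by simp)] at h1
      rw [SimpleGraph.Walk.isPath_def, SimpleGraph.Walk.support_append]
      exact (List.perm_append_comm.nodup_iff).1 (by simpa [SimpleGraph.Adj.toWalk] using h1)
    · have h1 := hc.isTrail.edges_nodup
      simp only [SimpleGraph.Walk.edges_append, SimpleGraph.Walk.edges_cons,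
        SimpleGraph.Walk.edges_nil, SimpleGraph.Adj.toWalk, List.append_assoc, List.cons_append,
        List.nil_append] at h1
      have h2 := (List.nodup_middle.1 h1)
      simp only [List.nodup_cons, List.mem_append] at h2
      simp only [SimpleGraph.Walk.edges_append, List.mem_append]
      tauto
    · intro e
      simp only [SimpleGraph.Walk.edges_append, SimpleGraph.Adj.toWalk, List.mem_append,
        SimpleGraph.Walk.edges_cons, SimpleGraph.Walk.edges_nil, List.mem_cons, List.not_mem_nil]
      tauto
  have h := c.adj_of_mem_edges he
  rcases (SimpleGraph.Walk.isSubwalk_toWalk_iff_mem_edges h).2 he with h1 | h1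
  · exact key h h1
  · obtain ⟨p, hp, hn, hiff⟩ := key h.symm h1
    refine ⟨p.reverse, hp.reverse, ?_, ?_⟩
    · rwa [SimpleGraph.Walk.edges_reverse, List.mem_reverse, Sym2.eq_swap]
    · intro e
      rw [hiff, SimpleGraph.Walk.edges_reverse, List.mem_reverse, Sym2.eq_swap]

theorem IsPolygon.exists_isPath {E : Finset (Sym2 Site)} (hE : IsPolygon E) {u w : Site}
    (he : s(u, w) ∈ E) :
    cubicLattice.Adj u w ∧ ∃ p : cubicLattice.Walk w u, p.IsPath ∧ s(u, w) ∉ p.edges ∧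
      ∀ e, e ∈ E ↔ e = s(u, w) ∨ e ∈ p.edges := by
  obtain ⟨v, c, hc, h⟩ := hE
  obtain ⟨p, hp, hn, hiff⟩ := hc.exists_isPath_of_mem_edges ((h _).1 he)
  exact ⟨c.adj_of_mem_edges ((h _).1 he), p, hp, hn, fun e => (h e).trans (hiff e)⟩

theorem isPolygon_of_isPath {E : Finset (Sym2 Site)} {u w : Site} (h : cubicLattice.Adj u w)
    {p : cubicLattice.Walk w u} (hp : p.IsPath) (hn : s(u, w) ∉ p.edges)
    (hE : ∀ e, e ∈ E ↔ e = s(u, w) ∨ e ∈ p.edges) : IsPolygon E :=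
  ⟨u, .cons h p, (SimpleGraph.Walk.cons_isCycle_iff _ _).2 ⟨hp, hn⟩, by simpa using hE⟩

theorem IsPolygon.adj {E : Finset (Sym2 Site)} (hE : IsPolygon E) {u w : Site}
    (he : s(u, w) ∈ E) : cubicLattice.Adj u w := (hE.exists_isPath he).1

theorem cubicLattice_adj_iff {u v : Site} :
    cubicLattice.Adj u v ↔ ∃ i, v = u + Pi.single i 1 ∨ u = v + Pi.single i 1 := by
  have key : ∀ a b : Site, ∀ i, a = b + Pi.single i 1 ↔
      ∀ j, a j = b j + if j = i then 1 else 0 := by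
    intro a b i
    rw [funext_iff]
    simp [Pi.single_apply]
  simp only [key]
  change ∑ i, |u i - v i| = 1 ↔ _
  simp only [Fin.sum_univ_three, Fin.forall_fin_succ, Fin.exists_fin_succ]
  simp
  rcases abs_cases (u 0 - v 0) with h0 | h0 <;> rcases abs_cases (u 1 - v 1) with h1 | h1 <;>
    rcases abs_cases (u 2 - v 2) with h2 | h2 <;> omega

theorem IsPolygon.exists_other_edge {E : Finset (Sym2 Site)} (hE : IsPolygon E) {v w : Site}
    (he : s(v, w) ∈ E) : ∃ w', w' ≠ w ∧ s(v, w') ∈ E := by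
  obtain ⟨h, p, hp, hn, hiff⟩ := hE.exists_isPath he
  cases hq : p.reverse with
  | nil => exact absurd rfl h.ne
  | cons h' q =>
    rename_i w'
    have hmem : s(v, w') ∈ p.edges := by
      rw [← List.mem_reverse, ← SimpleGraph.Walk.edges_reverse, hq]
      simp
    refine ⟨w', ?_, (hiff _).2 (.inr hmem)⟩
    rintro rfl
    exact hn hmem

theorem mem_occupiedSites_left {E : Finset (Sym2 Site)} {u w : Site} (h : s(u, w) ∈ E) :
    u ∈ occupiedSites E := ⟨_, h, Sym2.mem_mk_left _ _⟩

theorem mem_occupiedSites_right {E : Finset (Sym2 Site)} {u w : Site} (h : s(u, w) ∈ E) :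
    w ∈ occupiedSites E := ⟨_, h, Sym2.mem_mk_right _ _⟩

theorem occupiedSites_image (φ : Site → Site) (E : Finset (Sym2 Site)) :
    occupiedSites (E.image (Sym2.map φ)) = φ '' occupiedSites E := by
  ext v
  constructor
  · rintro ⟨e, he, hv⟩
    obtain ⟨e', he', rfl⟩ := Finset.mem_image.1 he
    obtain ⟨a, ha, rfl⟩ := Sym2.mem_map.1 hv
    exact ⟨a, ⟨e', he', ha⟩, rfl⟩
  · rintro ⟨a, ⟨e, he, ha⟩, rfl⟩
    exact ⟨_, Finset.mem_image_of_mem _ he, Sym2.mem_map.2 ⟨a, ha, rfl⟩⟩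

theorem IsPolygon.image {E : Finset (Sym2 Site)} (hE : IsPolygon E) {φ : Site → Site}
    (hinj : Function.Injective φ)
    (hadj : ∀ {u v}, cubicLattice.Adj u v → cubicLattice.Adj (φ u) (φ v)) :
    IsPolygon (E.image (Sym2.map φ)) := by
  obtain ⟨v, c, hc, h⟩ := hE
  let f : cubicLattice →g cubicLattice := ⟨φ, hadj⟩
  refine ⟨φ v, c.map f, (SimpleGraph.Walk.isCycle_map_iff_of_injective (f := f) hinj).2 hc, ?_⟩
  intro e
  simp only [SimpleGraph.Walk.edges_map, List.mem_map, Finset.mem_image, h]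
  rfl

/-- An extremal site of a polygon in the `x`-direction comes with an edge orthogonal to that
direction. -/
theorem IsPolygon.exists_edge_of_extremal {E : Finset (Sym2 Site)} (hE : IsPolygon E) {v : Site}
    (hv : v ∈ occupiedSites E)
    (hext : (∀ x ∈ occupiedSites E, x 0 ≤ v 0) ∨ ∀ x ∈ occupiedSites E, v 0 ≤ x 0) :
    ∃ (u : Site) (i : Fin 3), i ≠ 0 ∧ u 0 = v 0 ∧ s(u, u + Pi.single i 1) ∈ E := by
  obtain ⟨w, hw, hw0⟩ : ∃ w, s(v, w) ∈ E ∧ w 0 = v 0 := by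
    obtain ⟨e, he, hve⟩ := hv
    obtain ⟨w, rfl⟩ := hve
    obtain ⟨w', hne, hw'⟩ := hE.exists_other_edge he
    -- Otherwise both edges at `v` point in the `x`-direction. Extremality allows only one of the
    -- two sides, so their far ends would coincide.
    by_contra! hcon
    have key : ∀ x, s(v, x) ∈ E → x = v + Pi.single 0 1 ∨ v = x + Pi.single 0 1 := by
      intro x hx
      obtain ⟨i, hi⟩ := cubicLattice_adj_iff.1 (hE.adj hx)
      by_cases h0 : i = 0
      · rwa [h0] at hi
      · exfalso
        refine hcon x hx ?_
        rcases hi with rfl | rfl <;> simp [Ne.symm h0]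
    have hpos : ∀ x : Site, (x + Pi.single 0 1 : Site) 0 = x 0 + 1 := fun x => by simp
    apply hne
    have m1 := mem_occupiedSites_right he
    have m2 := mem_occupiedSites_right hw'
    rcases hext with hext | hext
    · have a1 := hext _ m1
      have a2 := hext _ m2
      rcases key _ he with h | h
      · rw [h, hpos] at a1; omega
      rcases key _ hw' with h' | h'
      · rw [h', hpos] at a2; omega
      exact add_right_cancel (h'.symm.trans h)
    · have a1 := hext _ m1
      have a2 := hext _ m2
      rcases key _ he with h | h
      · rcases key _ hw' with h' | h'
        · rw [h, h']
        · rw [h', hpos] at a2; omega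
      · rw [h, hpos] at a1; omega
  obtain ⟨i, hi⟩ := cubicLattice_adj_iff.1 (hE.adj hw)
  have hi0 : i ≠ 0 := by
    rintro rfl
    rcases hi with h | h <;> rw [h] at hw0 <;> simp at hw0
  rcases hi with h | h
  · exact ⟨v, i, hi0, rfl, h ▸ hw⟩
  · refine ⟨w, i, hi0, hw0, ?_⟩
    rw [← h, Sym2.eq_swap]
    exact hw

/-! ### Joining two polygons across adjacent planes -/

/-- The unit vector in the `x`-direction. -/
def unitX : Site := Pi.single 0 1

@[simp] theorem unitX_zero : unitX 0 = 1 := by simp [unitX]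

theorem adj_add_unitX (u : Site) : cubicLattice.Adj u (u + unitX) :=
  cubicLattice_adj_iff.2 ⟨0, .inl rfl⟩

/-- Two polygons, with parallel edges facing each other in adjacent planes, are joined by
replacing these two edges with two edges in the `x`-direction. -/
def joinPolygons (E₁ E₂ : Finset (Sym2 Site)) (u w : Site) : Finset (Sym2 Site) :=
  (E₁.erase s(u, w) ∪ E₂.erase s(u + unitX, w + unitX)) ∪ {s(u, u + unitX), s(w, w + unitX)}

theorem mem_joinPolygons {E₁ E₂ : Finset (Sym2 Site)} {u w : Site} {e : Sym2 Site} :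
    e ∈ joinPolygons E₁ E₂ u w ↔ (e ≠ s(u, w) ∧ e ∈ E₁) ∨
      (e ≠ s(u + unitX, w + unitX) ∧ e ∈ E₂) ∨ e = s(u, u + unitX) ∨ e = s(w, w + unitX) := by
  simp only [joinPolygons, Finset.mem_union, Finset.mem_erase, Finset.mem_insert,
    Finset.mem_singleton, or_assoc]

open Classical in
/-- The edges of `E` which lie in the half-space `x ≤ k`. -/
noncomputable def edgesBelow (k : ℤ) (E : Finset (Sym2 Site)) : Finset (Sym2 Site) :=
  E.filter fun e => ∀ v ∈ e, v 0 ≤ k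

theorem mem_edgesBelow {k : ℤ} {E : Finset (Sym2 Site)} {e : Sym2 Site} :
    e ∈ edgesBelow k E ↔ e ∈ E ∧ ∀ v ∈ e, v 0 ≤ k := by
  simp [edgesBelow]

/-- The edges of `E` in the half-space `x ≤ k`, closed up by edges joining the lower ends of the
edges of `E` which leave that half-space. -/
def lowerTrace (k : ℤ) (E : Finset (Sym2 Site)) : Set (Sym2 Site) :=
  {e | e ∈ E ∧ ∀ v ∈ e, v 0 ≤ k} ∪ {e | ∃ u w : Site, u ≠ w ∧ u 0 = k ∧ w 0 = k ∧
    s(u, u + unitX) ∈ E ∧ s(w, w + unitX) ∈ E ∧ e = s(u, w)}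

/-- The edges of `E` in the half-space `x > k`, closed up by edges joining the upper ends of the
edges of `E` which leave that half-space. -/
def upperTrace (k : ℤ) (E : Finset (Sym2 Site)) : Set (Sym2 Site) :=
  {e | e ∈ E ∧ ∀ v ∈ e, k < v 0} ∪ {e | ∃ u w : Site, u ≠ w ∧ u 0 = k ∧ w 0 = k ∧
    s(u, u + unitX) ∈ E ∧ s(w, w + unitX) ∈ E ∧ e = s(u + unitX, w + unitX)}

section Join

variable {E₁ E₂ : Finset (Sym2 Site)} {k : ℤ} {u w : Site}

/-- Deleting the facing edges leaves a path in each polygon, and the two `x`-edges close these up to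
one cycle. The paths are disjoint because the plane `x = k` bounds one from above and lies strictly
below the other. -/
theorem isPolygon_joinPolygons (h₁ : IsPolygon E₁) (h₂ : IsPolygon E₂)
    (hk₁ : ∀ v ∈ occupiedSites E₁, v 0 ≤ k) (hk₂ : ∀ v ∈ occupiedSites E₂, k < v 0)
    (he₁ : s(u, w) ∈ E₁) (he₂ : s(u + unitX, w + unitX) ∈ E₂) :
    IsPolygon (joinPolygons E₁ E₂ u w) := by
  obtain ⟨huw, p, hp, hpn, hpE⟩ := h₁.exists_isPath he₁
  obtain ⟨huw', q, hq, hqn, hqE⟩ := h₂.exists_isPath he₂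
  have hp0 : ∀ e ∈ p.edges, ∀ v ∈ e, v 0 ≤ k := fun e he v hv => hk₁ v ⟨e, (hpE e).2 (.inr he), hv⟩
  have hq0 : ∀ e ∈ q.edges, ∀ v ∈ e, k < v 0 := fun e he v hv => hk₂ v ⟨e, (hqE e).2 (.inr he), hv⟩
  have hps : ∀ v ∈ p.support, v 0 ≤ k := by
    intro v hv
    rcases SimpleGraph.Walk.mem_support_iff_exists_mem_edges.1 hv with rfl | ⟨e, he, hve⟩
    · exact hk₁ _ (mem_occupiedSites_left he₁)
    · exact hp0 e he v hve
  have hqs : ∀ v ∈ q.support, k < v 0 := by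
    intro v hv
    rcases SimpleGraph.Walk.mem_support_iff_exists_mem_edges.1 hv with rfl | ⟨e, he, hve⟩
    · exact hk₂ _ (mem_occupiedSites_left he₂)
    · exact hq0 e he v hve
  refine isPolygon_of_isPath (adj_add_unitX u)
    (p := q.reverse.append (.cons (adj_add_unitX w).symm p)) ?_ ?_ ?_
  · rw [SimpleGraph.Walk.isPath_def, SimpleGraph.Walk.support_append,
      SimpleGraph.Walk.support_cons, List.tail_cons, SimpleGraph.Walk.support_reverse]
    refine List.nodup_append'.2 ⟨List.nodup_reverse.2 hq.support_nodup, hp.support_nodup, ?_⟩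
    intro v hv hv'
    have a := hqs v (List.mem_reverse.1 hv)
    have b := hps v hv'
    omega
  · simp only [SimpleGraph.Walk.edges_append, SimpleGraph.Walk.edges_cons,
      SimpleGraph.Walk.edges_reverse, List.mem_append, List.mem_reverse, List.mem_cons, not_or]
    refine ⟨fun h => ?_, fun h => ?_, fun h => ?_⟩
    · have a := hq0 _ h u (Sym2.mem_mk_left _ _)
      have b := hk₁ _ (mem_occupiedSites_left he₁)
      omega
    · rw [Sym2.eq_swap (a := w + unitX)] at h
      rcases Sym2.eq_iff.1 h with h | h
      · exact huw.ne h.1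
      · have a := congrFun h.1 0
        have b := congrFun h.2 0
        simp at a b
        omega
    · have a := hp0 _ h (u + unitX) (Sym2.mem_mk_right _ _)
      have b := hk₂ _ (mem_occupiedSites_left he₂)
      omega
  · intro e
    rw [mem_joinPolygons]
    simp only [SimpleGraph.Walk.edges_append, SimpleGraph.Walk.edges_cons,
      SimpleGraph.Walk.edges_reverse, List.mem_append, List.mem_reverse, List.mem_cons, hpE, hqE]
    rw [Sym2.eq_swap (a := w + unitX)]
    have a : e ∈ p.edges → e ≠ s(u, w) := by rintro h rfl; exact hpn h
    have b : e ∈ q.edges → e ≠ s(u + unitX, w + unitX) := by rintro h rfl; exact hqn h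
    tauto

theorem occupiedSites_joinPolygons (he₁ : s(u, w) ∈ E₁) (he₂ : s(u + unitX, w + unitX) ∈ E₂) :
    occupiedSites (joinPolygons E₁ E₂ u w) = occupiedSites E₁ ∪ occupiedSites E₂ := by
  have m1 : s(u, u + unitX) ∈ joinPolygons E₁ E₂ u w := by simp [mem_joinPolygons]
  have m2 : s(w, w + unitX) ∈ joinPolygons E₁ E₂ u w := by simp [mem_joinPolygons]
  ext v
  constructor
  · rintro ⟨e, he, hv⟩
    rcases mem_joinPolygons.1 he with h | h | rfl | rfl
    · exact .inl ⟨e, h.2, hv⟩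
    · exact .inr ⟨e, h.2, hv⟩
    · rcases Sym2.mem_iff.1 hv with rfl | rfl
      · exact .inl (mem_occupiedSites_left he₁)
      · exact .inr (mem_occupiedSites_left he₂)
    · rcases Sym2.mem_iff.1 hv with rfl | rfl
      · exact .inl (mem_occupiedSites_right he₁)
      · exact .inr (mem_occupiedSites_right he₂)
  · rintro (⟨e, he, hv⟩ | ⟨e, he, hv⟩)
    · by_cases h : e = s(u, w)
      · subst h
        rcases Sym2.mem_iff.1 hv with rfl | rfl
        · exact mem_occupiedSites_left m1
        · exact mem_occupiedSites_left m2
      · exact ⟨e, mem_joinPolygons.2 (.inl ⟨h, he⟩), hv⟩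
    · by_cases h : e = s(u + unitX, w + unitX)
      · subst h
        rcases Sym2.mem_iff.1 hv with rfl | rfl
        · exact mem_occupiedSites_right m1
        · exact mem_occupiedSites_right m2
      · exact ⟨e, mem_joinPolygons.2 (.inr (.inl ⟨h, he⟩)), hv⟩

variable (hk₁ : ∀ v ∈ occupiedSites E₁, v 0 ≤ k) (hk₂ : ∀ v ∈ occupiedSites E₂, k < v 0)
  (hu : u 0 = k) (hw : w 0 = k)
include hk₁ hk₂ hu hw

theorem mem_joinPolygons_and_below_iff {e : Sym2 Site} :
    (e ∈ joinPolygons E₁ E₂ u w ∧ ∀ v ∈ e, v 0 ≤ k) ↔ e ≠ s(u, w) ∧ e ∈ E₁ := by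
  constructor
  · rintro ⟨he, hv⟩
    rcases mem_joinPolygons.1 he with h | h | rfl | rfl
    · exact h
    · induction e with | _ a b
      have x := hv a (Sym2.mem_mk_left _ _)
      have y := hk₂ a (mem_occupiedSites_left h.2)
      omega
    · have x := hv _ (Sym2.mem_mk_right _ _)
      simp at x; omega
    · have x := hv _ (Sym2.mem_mk_right _ _)
      simp at x; omega
  · intro h
    exact ⟨mem_joinPolygons.2 (.inl h), fun v hv => hk₁ v ⟨e, h.2, hv⟩⟩

theorem mem_joinPolygons_and_above_iff {e : Sym2 Site} :
    (e ∈ joinPolygons E₁ E₂ u w ∧ ∀ v ∈ e, k < v 0) ↔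
      e ≠ s(u + unitX, w + unitX) ∧ e ∈ E₂ := by
  constructor
  · rintro ⟨he, hv⟩
    rcases mem_joinPolygons.1 he with h | h | rfl | rfl
    · induction e with | _ a b
      have x := hv a (Sym2.mem_mk_left _ _)
      have y := hk₁ a (mem_occupiedSites_left h.2)
      omega
    · exact h
    · have x := hv _ (Sym2.mem_mk_left _ _)
      omega
    · have x := hv _ (Sym2.mem_mk_left _ _)
      omega
  · intro h
    exact ⟨mem_joinPolygons.2 (.inr (.inl h)), fun v hv => hk₂ v ⟨e, h.2, hv⟩⟩

/-- Only two edges cross between the planes, so the closing edge in `lowerTrace` and `upperTrace` is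
forced to be the deleted one. This makes the joining reversible. -/
theorem eq_or_eq_of_mem_joinPolygons {x : Site} (hx : x 0 = k)
    (h : s(x, x + unitX) ∈ joinPolygons E₁ E₂ u w) : x = u ∨ x = w := by
  rcases mem_joinPolygons.1 h with h | h | h | h
  · have := hk₁ _ (mem_occupiedSites_right h.2)
    simp at this; omega
  · have := hk₂ _ (mem_occupiedSites_left h.2)
    omega
  · rcases Sym2.eq_iff.1 h with h | h
    · exact .inl h.1
    · have := congrFun h.1 0
      simp at this; omega
  · rcases Sym2.eq_iff.1 h with h | h
    · exact .inr h.1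
    · have := congrFun h.1 0
      simp at this; omega

theorem lowerTrace_joinPolygons (huw : u ≠ w) (he₁ : s(u, w) ∈ E₁) :
    lowerTrace k (joinPolygons E₁ E₂ u w) = E₁ := by
  ext e
  change (_ ∧ _) ∨ _ ↔ e ∈ E₁
  rw [mem_joinPolygons_and_below_iff hk₁ hk₂ hu hw]
  constructor
  · rintro (h | ⟨x, y, hne, hx, hy, hxm, hym, rfl⟩)
    · exact h.2
    · rcases eq_or_eq_of_mem_joinPolygons hk₁ hk₂ hu hw hx hxm with rfl | rfl <;>
      rcases eq_or_eq_of_mem_joinPolygons hk₁ hk₂ hu hw hy hym with rfl | rfl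
      · exact absurd rfl hne
      · exact he₁
      · rwa [Sym2.eq_swap]
      · exact absurd rfl hne
  · intro h
    by_cases heq : e = s(u, w)
    · exact .inr ⟨u, w, huw, hu, hw, by simp [mem_joinPolygons], by simp [mem_joinPolygons], heq⟩
    · exact .inl ⟨heq, h⟩

theorem upperTrace_joinPolygons (huw : u ≠ w) (he₂ : s(u + unitX, w + unitX) ∈ E₂) :
    upperTrace k (joinPolygons E₁ E₂ u w) = E₂ := by
  ext e
  change (_ ∧ _) ∨ _ ↔ e ∈ E₂
  rw [mem_joinPolygons_and_above_iff hk₁ hk₂ hu hw]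
  constructor
  · rintro (h | ⟨x, y, hne, hx, hy, hxm, hym, rfl⟩)
    · exact h.2
    · rcases eq_or_eq_of_mem_joinPolygons hk₁ hk₂ hu hw hx hxm with rfl | rfl <;>
      rcases eq_or_eq_of_mem_joinPolygons hk₁ hk₂ hu hw hy hym with rfl | rfl
      · exact absurd rfl hne
      · exact he₂
      · rwa [Sym2.eq_swap]
      · exact absurd rfl hne
  · intro h
    by_cases heq : e = s(u + unitX, w + unitX)
    · exact .inr ⟨u, w, huw, hu, hw, by simp [mem_joinPolygons], by simp [mem_joinPolygons], heq⟩
    · exact .inl ⟨heq, h⟩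

theorem edgesBelow_joinPolygons :
    edgesBelow k (joinPolygons E₁ E₂ u w) = E₁.erase s(u, w) := by
  ext e
  rw [mem_edgesBelow, mem_joinPolygons_and_below_iff hk₁ hk₂ hu hw,
    Finset.mem_erase]

theorem card_joinPolygons (huw : u ≠ w) (he₁ : s(u, w) ∈ E₁)
    (he₂ : s(u + unitX, w + unitX) ∈ E₂) :
    (joinPolygons E₁ E₂ u w).card = E₁.card + E₂.card := by
  have h1 : 0 < E₁.card := Finset.card_pos.2 ⟨_, he₁⟩
  have h2 : 0 < E₂.card := Finset.card_pos.2 ⟨_, he₂⟩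
  have hd1 : Disjoint (E₁.erase s(u, w)) (E₂.erase s(u + unitX, w + unitX)) := by
    rw [Finset.disjoint_left]
    intro e h h'
    induction e with | _ a b
    have x := hk₁ a (mem_occupiedSites_left (Finset.mem_of_mem_erase h))
    have y := hk₂ a (mem_occupiedSites_left (Finset.mem_of_mem_erase h'))
    omega
  have hcross : ∀ x : Site, x 0 = k → s(x, x + unitX) ∉ E₁ ∧ s(x, x + unitX) ∉ E₂ := by
    intro x hx
    refine ⟨fun h => ?_, fun h => ?_⟩
    · have := hk₁ _ (mem_occupiedSites_right h)
      simp at this; omega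
    · have := hk₂ _ (mem_occupiedSites_left h)
      omega
  have hd2 : Disjoint (E₁.erase s(u, w) ∪ E₂.erase s(u + unitX, w + unitX))
      {s(u, u + unitX), s(w, w + unitX)} := by
    rw [Finset.disjoint_right]
    intro e h h'
    have hu' := hcross u hu
    have hw' := hcross w hw
    simp only [Finset.mem_insert, Finset.mem_singleton] at h
    rcases Finset.mem_union.1 h' with h' | h' <;> have h' := Finset.mem_of_mem_erase h' <;>
      rcases h with rfl | rfl <;> tauto
  have hne : s(u, u + unitX) ≠ s(w, w + unitX) := by
    intro h
    rcases Sym2.eq_iff.1 h with h | h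
    · exact huw h.1
    · have := congrFun h.1 0
      simp at this; omega
  rw [joinPolygons, Finset.card_union_of_disjoint hd2, Finset.card_union_of_disjoint hd1,
    Finset.card_erase_of_mem he₁, Finset.card_erase_of_mem he₂, Finset.card_pair hne]
  omega

end Join

/-! ### Concatenation of half-space polygons -/

/-- The translate by `t` of a site, reflected beforehand in the plane `y = z` if `b` holds. -/
def place (b : Bool) (t v : Site) : Site :=
  (if b then ![v 0, v 2, v 1] else v) + t

theorem place_apply_zero (b : Bool) (t v : Site) : place b t v 0 = v 0 + t 0 := by
  cases b <;> simp [place]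

theorem place_eq (b : Bool) (t v : Site) : place b t v = place b 0 v + t := by
  simp [place]

theorem place_add (b : Bool) (t v d : Site) : place b t (v + d) = place b t v + place b 0 d := by
  have h : place b 0 (v + d) = place b 0 v + place b 0 d := by
    cases b
    · simp [place]
    · ext i
      fin_cases i <;> simp [place]
  rw [place_eq, place_eq b t v, h, add_right_comm]

theorem place_zero_involutive (b : Bool) : Function.Involutive (place b 0) := by
  intro v
  cases b
  · simp [place]
  · ext i
    fin_cases i <;> simp [place]

theorem place_injective (b : Bool) (t : Site) : Function.Injective (place b t) := by
  intro u v h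
  rw [place_eq b t, place_eq b t v] at h
  exact (place_zero_involutive b).injective (add_right_cancel h)

theorem cubicLattice_adj_place (b : Bool) (t : Site) {u v : Site} (h : cubicLattice.Adj u v) :
    cubicLattice.Adj (place b t u) (place b t v) := by
  change ∑ i, |u i - v i| = 1 at h
  change ∑ i, |place b t u i - place b t v i| = 1
  cases b
  · simpa [place] using h
  · simp only [Fin.sum_univ_three] at h ⊢
    simp [place]
    omega

theorem exists_place_single {i j : Fin 3} (hi : i ≠ 0) (hj : j ≠ 0) :
    ∃ b, place b 0 (Pi.single j 1) = Pi.single i 1 := by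
  by_cases h : i = j
  · exact ⟨false, by simp [place, h]⟩
  · refine ⟨true, ?_⟩
    fin_cases i <;> fin_cases j <;> simp at hi hj h ⊢ <;> ext l <;> fin_cases l <;>
      simp [place]

/-- Besides the joined polygon, this records what is needed to undo the construction: the two traces
at the cutting level, and the edge count and crossing edge that identify this level. -/
theorem exists_concatenation {n₁ n₂ s₁ s₂ : ℕ} {E₁ E₂ : Finset (Sym2 Site)}
    (h₁ : E₁ ∈ halfSpacePolygons n₁ s₁) (h₂ : E₂ ∈ halfSpacePolygons n₂ s₂) :
    ∃ E ∈ halfSpacePolygons (n₁ + n₂) (s₁ + s₂ + 1), ∃ (b : Bool) (t : Site), t 0 = s₁ + 1 ∧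
      lowerTrace s₁ E = E₁ ∧ upperTrace s₁ E = E₂.image (Sym2.map (place b t)) ∧
      (edgesBelow s₁ E).card = n₁ - 1 ∧ ∃ u : Site, u 0 = s₁ ∧ s(u, u + unitX) ∈ E := by
  obtain ⟨hp₁, hc₁, hnn₁, ⟨e₁, he₁, hb₁⟩, ⟨v₁, hv₁, hvs₁⟩, hub₁⟩ := h₁
  obtain ⟨hp₂, hc₂, hnn₂, ⟨e₂, he₂, hb₂⟩, ⟨v₂, hv₂, hvs₂⟩, hub₂⟩ := h₂
  dsimp only at hvs₁ hvs₂
  replace hub₁ : ∀ v ∈ occupiedSites E₁, v 0 ≤ s₁ := fun v hv => hub₁ ⟨v, hv, rfl⟩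
  replace hub₂ : ∀ v ∈ occupiedSites E₂, v 0 ≤ s₂ := fun v hv => hub₂ ⟨v, hv, rfl⟩
  obtain ⟨u, i, hi, hu, hui⟩ := hp₁.exists_edge_of_extremal hv₁ (.inl (by rwa [hvs₁]))
  rw [hvs₁] at hu
  obtain ⟨a₁, ha₁⟩ : ∃ a, a ∈ e₁ := by induction e₁ with | _ a b; exact ⟨a, by simp⟩
  obtain ⟨a₂, ha₂⟩ : ∃ a, a ∈ e₂ := by induction e₂ with | _ a b; exact ⟨a, by simp⟩
  obtain ⟨u', j, hj, hu', huj⟩ := hp₂.exists_edge_of_extremal (v := a₂) ⟨e₂, he₂, ha₂⟩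
    (.inr (by rwa [hb₂ _ ha₂]))
  rw [hb₂ _ ha₂] at hu'
  obtain ⟨b, hb⟩ := exists_place_single hi hj
  -- This translation puts the chosen bottom edge of `E₂` directly above the chosen top edge of
  -- `E₁`.
  set t : Site := u + unitX - place b 0 u' with ht
  have ht0 : t 0 = s₁ + 1 := by simp [ht, place_apply_zero, hu, hu']
  set E₂' := E₂.image (Sym2.map (place b t)) with hE₂'
  set w := u + Pi.single i 1 with hw
  have hw0 : w 0 = s₁ := by simp [hw, hi.symm, hu]
  have huw : u ≠ w := by simp [hw]
  have pu : place b t u' = u + unitX := by rw [place_eq, ht]; abel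
  have pw : place b t (u' + Pi.single j 1) = w + unitX := by
    rw [place_add, pu, hb, hw]; abel
  have he₂' : s(u + unitX, w + unitX) ∈ E₂' := by
    rw [← pu, ← pw]
    exact Finset.mem_image.2 ⟨_, huj, rfl⟩
  have hp₂' : IsPolygon E₂' := hp₂.image (place_injective b t) (cubicLattice_adj_place b t)
  have hocc : occupiedSites E₂' = place b t '' occupiedSites E₂ := occupiedSites_image _ _
  have hk₂ : ∀ v ∈ occupiedSites E₂', (s₁ : ℤ) < v 0 := by
    rw [hocc]
    rintro _ ⟨v, hv, rfl⟩
    have := hnn₂ v hv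
    rw [place_apply_zero, ht0]; omega
  have hcard : E₂'.card = n₂ := by
    rw [hE₂', Finset.card_image_of_injective _ (Sym2.map.injective (place_injective b t)), hc₂]
  have hoccE := occupiedSites_joinPolygons hui he₂'
  have hpE := isPolygon_joinPolygons hp₁ hp₂' hub₁ hk₂ hui he₂'
  have hnn : ∀ v ∈ occupiedSites (joinPolygons E₁ E₂' u w), 0 ≤ v 0 := by
    rw [hoccE]
    rintro v (hv | hv)
    · exact hnn₁ v hv
    · have := hk₂ v hv; omega
  refine ⟨joinPolygons E₁ E₂' u w, ⟨hpE, ?_, hnn, ?_, ?_, ?_⟩, b, t, ht0,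
    lowerTrace_joinPolygons hub₁ hk₂ hu hw0 huw hui,
    upperTrace_joinPolygons hub₁ hk₂ hu hw0 huw he₂', ?_, u, hu, by simp [mem_joinPolygons]⟩
  · rw [card_joinPolygons hub₁ hk₂ hu hw0 huw hui he₂', hc₁, hcard]
  · have ha : a₁ ∈ occupiedSites (joinPolygons E₁ E₂' u w) := by
      rw [hoccE]; exact .inl ⟨e₁, he₁, ha₁⟩
    -- If `s₁ = 0`, the edge `e₁` may be the one deleted, so an edge in the plane `x = 0` is found
    -- afresh at a lowest site.
    obtain ⟨x, l, hl, hx, hxl⟩ := hpE.exists_edge_of_extremal ha (.inr (by rwa [hb₁ _ ha₁]))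
    rw [hb₁ _ ha₁] at hx
    refine ⟨_, hxl, fun v hv => ?_⟩
    rcases Sym2.mem_iff.1 hv with rfl | rfl
    · exact hx
    · simp [hl.symm, hx]
  · refine ⟨place b t v₂, ?_, ?_⟩
    · rw [hoccE, hocc]; exact .inr ⟨v₂, hv₂, rfl⟩
    · simp only [place_apply_zero, hvs₂, ht0]
      push_cast; ring
  · rintro _ ⟨v, hv, rfl⟩
    rw [hoccE, hocc] at hv
    push_cast
    rcases hv with hv | ⟨v, hv, rfl⟩
    · have := hub₁ v hv
      change v 0 ≤ _
      omega
    · have := hub₂ v hv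
      simp only [place_apply_zero, ht0]; omega
  · rw [edgesBelow_joinPolygons hub₁ hk₂ hu hw0, Finset.card_erase_of_mem hui, hc₁]

/-! ### Words of steps without immediate reversals -/

/-- The edges of the walk which starts at `v` and makes the given steps. -/
def edgesFrom : Site → List Site → List (Sym2 Site)
  | _, [] => []
  | v, d :: l => s(v, v + d) :: edgesFrom (v + d) l

theorem edgesFrom_add (v t : Site) (l : List Site) :
    edgesFrom (v + t) l = (edgesFrom v l).map (Sym2.map (· + t)) := by
  induction l generalizing v with
  | nil => rfl
  | cons d l ih =>
    simp only [edgesFrom, List.map_cons, Sym2.map_mk, ← ih]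
    rw [add_right_comm]

/-- The steps of a walk. -/
def walkSteps {u v : Site} (p : cubicLattice.Walk u v) : List Site :=
  p.darts.map fun d => d.snd - d.fst

@[simp] theorem walkSteps_nil (u : Site) :
    walkSteps (.nil : cubicLattice.Walk u u) = [] := rfl

@[simp] theorem walkSteps_cons {u v w : Site} (h : cubicLattice.Adj u v)
    (p : cubicLattice.Walk v w) : walkSteps (.cons h p) = (v - u) :: walkSteps p := rfl

theorem walkSteps_append {u v w : Site} (p : cubicLattice.Walk u v) (q : cubicLattice.Walk v w) :
    walkSteps (p.append q) = walkSteps p ++ walkSteps q := by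
  simp [walkSteps]

theorem length_walkSteps {u v : Site} (p : cubicLattice.Walk u v) :
    (walkSteps p).length = p.length := by
  simp [walkSteps]

theorem edges_eq_edgesFrom {u v : Site} (p : cubicLattice.Walk u v) :
    p.edges = edgesFrom u (walkSteps p) := by
  induction p with
  | nil => rfl
  | cons h p ih => simp [edgesFrom, ih]

/-- An immediate reversal would traverse the same edge twice. -/
theorem isChain_walkSteps {u v : Site} {p : cubicLattice.Walk u v} (hp : p.IsTrail) :
    (walkSteps p).IsChain fun d d' => d' ≠ -d := by
  induction p with
  | nil => exact .nil
  | cons h p ih =>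
    rename_i u v w
    cases p with
    | nil => exact .singleton _
    | cons h' q =>
      rename_i x
      rw [SimpleGraph.Walk.isTrail_cons] at hp
      refine List.IsChain.cons_cons ?_ (ih hp.1)
      intro heq
      rw [neg_sub, sub_left_inj] at heq
      subst heq
      apply hp.2
      simp [Sym2.eq_swap]

/-- The number of steps in the `x`-direction. -/
def countX (l : List Site) : ℕ := l.countP fun d => d 0 ≠ 0

theorem abs_sub_le_countX {u v : Site} (p : cubicLattice.Walk u v) :
    |v 0 - u 0| ≤ countX (walkSteps p) := by
  induction p with
  | nil => simp
  | cons h p ih =>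
    rename_i u v w
    rw [walkSteps_cons, countX, List.countP_cons, ← countX]
    have h1 : |v 0 - u 0| ≤ 1 := by
      obtain ⟨i, rfl | rfl⟩ := cubicLattice_adj_iff.1 h <;> by_cases hi : 0 = i <;>
        simp [hi]
    have h2 := abs_sub_le (w 0) (v 0) (u 0)
    by_cases h0 : v 0 - u 0 = 0
    · rw [h0, abs_zero] at h2
      push_cast
      omega
    · rw [if_pos (by simpa using h0)]
      push_cast
      omega

/-- The closed walk has to reach `w` and come back, and each part uses at least `w 0 - v 0` steps in
the `x`-direction. -/
theorem two_mul_le_countX {v w : Site} (c : cubicLattice.Walk v v) (hw : w ∈ c.support) :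
    2 * (w 0 - v 0) ≤ countX (walkSteps c) := by
  have h1 := abs_sub_le_countX (c.takeUntil w hw)
  have h2 := abs_sub_le_countX (c.dropUntil w hw)
  rw [← c.take_spec hw, walkSteps_append, countX, List.countP_append, ← countX, ← countX]
  have h3 := le_abs_self (w 0 - v 0)
  have h4 := neg_abs_le (v 0 - w 0)
  push_cast
  omega

/-- The six unit vectors of the lattice. -/
def unitStep (c : Fin 3 × Bool) : Site := Pi.single c.1 (if c.2 then 1 else -1)

theorem unitStep_injective : Function.Injective unitStep := by
  decide

theorem neg_unitStep (i : Fin 3) (b : Bool) : -unitStep (i, b) = unitStep (i, !b) := by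
  cases b <;> simp [unitStep, ← Pi.single_neg]

theorem exists_unitStep_of_mem_walkSteps {u v : Site} {p : cubicLattice.Walk u v} {d : Site}
    (hd : d ∈ walkSteps p) : ∃ c, unitStep c = d := by
  obtain ⟨x, -, rfl⟩ := List.mem_map.1 hd
  obtain ⟨i, h | h⟩ := cubicLattice_adj_iff.1 x.adj
  · exact ⟨(i, true), by rw [h]; simp [unitStep]⟩
  · exact ⟨(i, false), by rw [h]; simp [unitStep, Pi.single_neg]⟩

/-- The words of `n` unit steps without immediate reversals which may follow the step `d`. -/
def wordsAfter : ℕ → Site → Finset (List Site)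
  | 0, _ => {[]}
  | n + 1, d => (Finset.univ.filter fun c => unitStep c ≠ -d).biUnion fun c =>
      (wordsAfter n (unitStep c)).image (List.cons (unitStep c))

theorem mem_wordsAfter {l : List Site} {d : Site} (hl : ∀ x ∈ l, ∃ c, unitStep c = x)
    (hc : (d :: l).IsChain fun d d' => d' ≠ -d) : l ∈ wordsAfter l.length d := by
  induction l generalizing d with
  | nil => simp [wordsAfter]
  | cons x l ih =>
    obtain ⟨c, rfl⟩ := hl x (by simp)
    rw [List.isChain_cons_cons] at hc
    simp only [List.length_cons, wordsAfter, Finset.mem_biUnion, Finset.mem_filter,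
      Finset.mem_univ, true_and, Finset.mem_image]
    exact ⟨c, hc.1, l, ih (fun y hy => hl y (by simp [hy])) hc.2, rfl⟩

/-- The factor 1 or 2 is a supersolution of the transfer matrix for the eigenvalue `a + 8`, indexed
by the type of the preceding step. -/
theorem sum_wordsAfter_le {a : ℝ} (ha : 0 ≤ a) (n : ℕ) (c : Fin 3 × Bool) :
    ∑ l ∈ wordsAfter n (unitStep c), a ^ countX l ≤ (if c.1 = 0 then 1 else 2) * (a + 8) ^ n := by
  induction n generalizing c with
  | zero =>
    simp only [wordsAfter, Finset.sum_singleton, countX, List.countP_nil, pow_zero, mul_one]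
    split_ifs <;> norm_num
  | succ n ih =>
    rw [wordsAfter, Finset.sum_biUnion]
    swap
    · intro x _ y _ hxy
      rw [Function.onFun, Finset.disjoint_left]
      intro l hl hl'
      obtain ⟨l₁, -, rfl⟩ := Finset.mem_image.1 hl
      obtain ⟨l₂, -, h⟩ := Finset.mem_image.1 hl'
      exact hxy (unitStep_injective (List.cons.inj h).1.symm)
    have step : ∀ x : Fin 3 × Bool,
        ∑ l ∈ (wordsAfter n (unitStep x)).image (List.cons (unitStep x)), a ^ countX l ≤
          (if x.1 = 0 then a else 2) * (a + 8) ^ n := by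
      intro x
      rw [Finset.sum_image (fun l _ l' _ h => (List.cons.inj h).2)]
      have hx : ∀ l, a ^ countX (unitStep x :: l) = (if x.1 = 0 then a else 1) * a ^ countX l := by
        intro l
        rw [countX, List.countP_cons, ← countX]
        have : unitStep x 0 ≠ 0 ↔ x.1 = 0 := by
          revert x; decide
        by_cases h : x.1 = 0 <;> simp [this, h, pow_succ, mul_comm]
      simp only [hx, ← Finset.mul_sum]
      have := ih x
      by_cases h : x.1 = 0
      · simp only [h, if_true, one_mul] at this ⊢
        gcongr
      · simpa [h] using this
    refine (Finset.sum_le_sum fun x _ => step x).trans ?_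
    rw [← Finset.sum_mul, pow_succ', ← mul_assoc]
    gcongr
    obtain ⟨i, b⟩ := c
    simp only [neg_unitStep, unitStep_injective.ne_iff, Finset.sum_filter,
      Fintype.sum_prod_type, Fin.sum_univ_three, Fintype.sum_bool]
    -- After an `x`-step, one `x`-step and four others are allowed: `a + 4 * 2 = a + 8`. After
    -- another step, two `x`-steps and three others are: `2 * a + 3 * 2 ≤ 2 * (a + 8)`.
    fin_cases i <;> cases b <;> simp <;> linarith

/-- The cycle is rotated to start at a site in the plane `x = 0`. -/
theorem exists_rooted_word {n s : ℕ} {E : Finset (Sym2 Site)} (hE : E ∈ halfSpacePolygons n s) :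
    ∃ (v : Site) (l : List Site), v 0 = 0 ∧ (∀ e, e ∈ E ↔ e ∈ edgesFrom v l) ∧
      l ∈ wordsAfter n (unitStep (1, true)) ∪ wordsAfter n (unitStep (2, true)) ∧
      2 * s ≤ countX l := by
  obtain ⟨⟨x, c, hc, hcE⟩, hcard, hnn, ⟨e, he, hb⟩, ⟨y, hy, hys⟩, -⟩ := hE
  have hsupp : ∀ z ∈ occupiedSites E, z ∈ c.support := by
    rintro z ⟨e, he, hz⟩
    exact SimpleGraph.Walk.mem_support_iff_exists_mem_edges.2 (.inr ⟨e, (hcE e).1 he, hz⟩)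
  obtain ⟨v, hve⟩ : ∃ v, v ∈ e := by induction e with | _ a b; exact ⟨a, by simp⟩
  have hv : v ∈ c.support := hsupp v ⟨e, he, hve⟩
  have hy' : y ∈ (c.rotate v hv).support :=
    (SimpleGraph.Walk.mem_support_rotate_iff ..).2 (hsupp y hy)
  have hlen : (walkSteps (c.rotate v hv)).length = n := by
    have : E = c.edges.toFinset := by ext e; simp [hcE]
    rw [length_walkSteps, SimpleGraph.Walk.length_rotate, ← SimpleGraph.Walk.length_edges,
      ← List.toFinset_card_of_nodup hc.isTrail.edges_nodup, ← this, hcard]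
  refine ⟨v, walkSteps (c.rotate v hv), hb v hve, fun e => ?_, ?_, ?_⟩
  · rw [← edges_eq_edgesFrom, (c.rotate_edges v hv).mem_iff, hcE]
  · have hch := isChain_walkSteps (hc.rotate hv).isTrail
    have hst : ∀ d ∈ walkSteps (c.rotate v hv), ∃ c, unitStep c = d :=
      fun d hd => exists_unitStep_of_mem_walkSteps hd
    rw [Finset.mem_union, ← hlen]
    generalize walkSteps (c.rotate v hv) = l at hch hst
    cases l with
    | nil => simp [wordsAfter]
    | cons d l =>
      -- The words of `wordsAfter` need a fictitious preceding step. The first step cannot reverse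
      -- both candidates, so one of the two sets contains the word.
      by_cases hd : d = -unitStep (1, true)
      · refine .inr (mem_wordsAfter hst (.cons_cons ?_ hch))
        rw [hd]
        decide
      · exact .inl (mem_wordsAfter hst (.cons_cons hd hch))
  · have := two_mul_le_countX _ hy'
    dsimp only at hys
    rw [hys, hb v hve] at this
    omega

/-! ### Translation classes, their words and the upper bound on the partition function -/

theorem translateYZ_eq_image {t : Site} (ht : t 0 = 0) (E : Finset (Sym2 Site)) :
    translateYZ (t 1) (t 2) E = E.image (Sym2.map (· + t)) := by
  have : ![0, t 1, t 2] = t := by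
    ext i
    fin_cases i <;> simp [ht]
  rw [translateYZ, this]

theorem span_eq_of_translateYZ {n n' s s' : ℕ} {E : Finset (Sym2 Site)} {a b : ℤ}
    (hE : E ∈ halfSpacePolygons n s) (hE' : translateYZ a b E ∈ halfSpacePolygons n' s') :
    s = s' := by
  have h := hE.2.2.2.2
  have h' := hE'.2.2.2.2
  rw [translateYZ, occupiedSites_image, Set.image_image] at h'
  simp only [Pi.add_apply, Matrix.cons_val_zero, add_zero] at h'
  exact_mod_cast h.unique h'

/-- The polygons with `n` edges of the half-space, up to translations, of any span. -/
abbrev PolygonClass (n : ℕ) : Type := Σ s : ℕ, Quotient (polygonSetoid n s)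

namespace PolygonClass

variable {n : ℕ}

/-- The class of a polygon. -/
def mk {s : ℕ} {E : Finset (Sym2 Site)} (h : E ∈ halfSpacePolygons n s) : PolygonClass n :=
  ⟨s, Quotient.mk _ ⟨E, h⟩⟩

/-- A polygon in the given class. -/
noncomputable def rep (q : PolygonClass n) : Finset (Sym2 Site) := q.2.out.1

theorem rep_mem (q : PolygonClass n) : q.rep ∈ halfSpacePolygons n q.1 := q.2.out.2

theorem mk_rep (q : PolygonClass n) : mk q.rep_mem = q := by
  obtain ⟨s, q⟩ := q
  exact congrArg (Sigma.mk s) (Quotient.out_eq q)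

theorem mk_eq_mk_iff {s s' : ℕ} {E E' : Finset (Sym2 Site)} {h : E ∈ halfSpacePolygons n s}
    {h' : E' ∈ halfSpacePolygons n s'} :
    mk h = mk h' ↔ ∃ a b : ℤ, E' = translateYZ a b E := by
  constructor
  · intro heq
    obtain ⟨rfl, heq⟩ := Sigma.mk.inj heq
    exact Quotient.exact (eq_of_heq heq)
  · rintro ⟨a, b, rfl⟩
    obtain rfl := span_eq_of_translateYZ h h'
    exact congrArg (Sigma.mk s) (Quotient.sound ⟨a, b, rfl⟩)

theorem eq_of_rep_eq {q q' : PolygonClass n} {a b : ℤ} (h : q'.rep = translateYZ a b q.rep) :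
    q = q' := by
  rw [← q.mk_rep, ← q'.mk_rep]
  exact mk_eq_mk_iff.2 ⟨a, b, h⟩

/-- A word of steps which describes the polygons of the given class. -/
noncomputable def word (q : PolygonClass n) : List Site :=
  (exists_rooted_word q.rep_mem).choose_spec.choose

theorem word_spec (q : PolygonClass n) : ∃ v : Site, v 0 = 0 ∧
    (∀ e, e ∈ q.rep ↔ e ∈ edgesFrom v q.word) ∧
      q.word ∈ wordsAfter n (unitStep (1, true)) ∪ wordsAfter n (unitStep (2, true)) ∧
      2 * q.1 ≤ countX q.word :=
  ⟨_, (exists_rooted_word q.rep_mem).choose_spec.choose_spec⟩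

/-- Walks with the same steps differ by the translation between their starting points, which has no
`x`-component since both lie in `x = 0`. -/
theorem word_injective : Function.Injective (word (n := n)) := by
  intro q q' h
  obtain ⟨v, hv, hE, -⟩ := q.word_spec
  obtain ⟨v', hv', hE', -⟩ := q'.word_spec
  have ht : (v' - v) 0 = 0 := by simp [hv, hv']
  refine eq_of_rep_eq (a := (v' - v) 1) (b := (v' - v) 2) ?_
  rw [translateYZ_eq_image ht]
  ext e
  rw [hE', ← h, ← add_sub_cancel v v', edgesFrom_add, add_sub_cancel]
  simp [hE]

instance : Finite (PolygonClass n) :=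
  Finite.of_injective
    (fun q => (⟨q.word, q.word_spec.choose_spec.2.2.1⟩ :
      (wordsAfter n (unitStep (1, true)) ∪ wordsAfter n (unitStep (2, true)) : Finset _)))
    fun _ _ h => word_injective (congrArg Subtype.val h)

noncomputable instance : Fintype (PolygonClass n) := Fintype.ofFinite _

end PolygonClass

theorem partitionFunction_eq_sum (n : ℕ) (f : ℝ) :
    partitionFunction n f = ∑ q : PolygonClass n, Real.exp (f * q.1) := by
  have hs : Summable fun q : PolygonClass n => Real.exp (f * q.1) := Summable.of_finite
  rw [← tsum_fintype (L := .unconditional _), hs.tsum_sigma' fun s => ?_]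
  · refine tsum_congr fun s => ?_
    change _ = ∑' _ : Quotient (polygonSetoid n s), Real.exp (f * s)
    rw [tsum_const, polygonCount, nsmul_eq_mul]
  · have : Finite (Quotient (polygonSetoid n s)) :=
      Finite.of_injective (Sigma.mk s : _ → PolygonClass n) sigma_mk_injective
    exact Summable.of_finite

/-- As `f ≥ 0`, `2 s ≤ countX` gives `e^{f s} ≤ (e^{f/2})^countX`. The constant 4 comes from two
sets of words, each with prefactor 2. -/
theorem partitionFunction_le {f : ℝ} (hf : 0 ≤ f) (n : ℕ) :
    partitionFunction n f ≤ 4 * (Real.exp (f / 2) + 8) ^ n := by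
  have ha := Real.exp_pos (f / 2)
  set W₁ := wordsAfter n (unitStep (1, true))
  set W₂ := wordsAfter n (unitStep (2, true))
  have h1 := sum_wordsAfter_le ha.le n (1, true)
  have h2 := sum_wordsAfter_le ha.le n (2, true)
  have h3 := Finset.sum_union_inter (s₁ := W₁) (s₂ := W₂)
    (f := fun l => Real.exp (f / 2) ^ countX l)
  have h4 : 0 ≤ ∑ l ∈ W₁ ∩ W₂, Real.exp (f / 2) ^ countX l :=
    Finset.sum_nonneg fun _ _ => by positivity
  simp only [one_ne_zero, if_false, Fin.reduceEq] at h1 h2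
  calc partitionFunction n f = ∑ q : PolygonClass n, Real.exp (f * q.1) :=
        partitionFunction_eq_sum n f
    _ ≤ ∑ q : PolygonClass n, Real.exp (f / 2) ^ countX q.word := by
        refine Finset.sum_le_sum fun q _ => ?_
        obtain ⟨-, -, -, -, h⟩ := q.word_spec
        rw [← Real.exp_nat_mul, Real.exp_le_exp]
        have : (2 * q.1 : ℝ) ≤ countX q.word := by exact_mod_cast h
        nlinarith
    _ = ∑ l ∈ Finset.univ.image (PolygonClass.word (n := n)), Real.exp (f / 2) ^ countX l :=
        (Finset.sum_image (f := fun l => Real.exp (f / 2) ^ countX l)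
          fun _ _ _ _ h => PolygonClass.word_injective h).symm
    _ ≤ ∑ l ∈ W₁ ∪ W₂, Real.exp (f / 2) ^ countX l := by
        refine Finset.sum_le_sum_of_subset_of_nonneg ?_ fun _ _ _ => by positivity
        intro l hl
        obtain ⟨q, -, rfl⟩ := Finset.mem_image.1 hl
        exact q.word_spec.choose_spec.2.2.1
    _ ≤ _ := by linarith

theorem partitionFunction_mono (n : ℕ) : Monotone (partitionFunction n) := by
  intro f g h
  rw [partitionFunction_eq_sum, partitionFunction_eq_sum]
  gcongr

/-! ### Recovering the two polygons; supermultiplicativity -/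

section Translation

variable {E : Finset (Sym2 Site)} {t : Site} (ht : t 0 = 0) {k : ℤ}

theorem sym2_map_add_injective (t : Site) : Function.Injective (Sym2.map (· + t)) :=
  Sym2.map.injective (add_left_injective t)

theorem mem_image_map_add {u w : Site} (h : s(u, w) ∈ E) :
    s(u + t, w + t) ∈ E.image (Sym2.map (· + t)) :=
  Finset.mem_image.2 ⟨_, h, rfl⟩

include ht

theorem forall_mem_map_add_iff (p : ℤ → Prop) (e : Sym2 Site) :
    (∀ v ∈ Sym2.map (· + t) e, p (v 0)) ↔ ∀ v ∈ e, p (v 0) := by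
  simp [Sym2.mem_map, ht]

theorem card_edgesBelow_image :
    (edgesBelow k (E.image (Sym2.map (· + t)))).card = (edgesBelow k E).card := by
  rw [← Finset.card_image_of_injective (edgesBelow k E) (sym2_map_add_injective t)]
  congr 1
  ext e
  simp only [mem_edgesBelow, Finset.mem_image]
  constructor
  · rintro ⟨⟨e, he, rfl⟩, h⟩
    exact ⟨e, ⟨he, (forall_mem_map_add_iff ht (· ≤ k) e).1 h⟩, rfl⟩
  · rintro ⟨e, ⟨he, h⟩, rfl⟩
    exact ⟨⟨e, he, rfl⟩, (forall_mem_map_add_iff ht (· ≤ k) e).2 h⟩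

theorem map_mem_lowerTrace {e : Sym2 Site} (he : e ∈ lowerTrace k E) :
    Sym2.map (· + t) e ∈ lowerTrace k (E.image (Sym2.map (· + t))) := by
  rcases he with ⟨he, h⟩ | ⟨u, w, hne, hu, hw, hue, hwe, rfl⟩
  · exact .inl ⟨Finset.mem_image_of_mem _ he, (forall_mem_map_add_iff ht (· ≤ k) e).2 h⟩
  · refine .inr ⟨u + t, w + t, by simpa using hne, by simp [ht, hu], by simp [ht, hw], ?_, ?_, rfl⟩
    · rw [add_right_comm]
      exact mem_image_map_add hue
    · rw [add_right_comm]
      exact mem_image_map_add hwe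

theorem map_mem_upperTrace {e : Sym2 Site} (he : e ∈ upperTrace k E) :
    Sym2.map (· + t) e ∈ upperTrace k (E.image (Sym2.map (· + t))) := by
  rcases he with ⟨he, h⟩ | ⟨u, w, hne, hu, hw, hue, hwe, rfl⟩
  · exact .inl ⟨Finset.mem_image_of_mem _ he, (forall_mem_map_add_iff ht (k < ·) e).2 h⟩
  · refine .inr ⟨u + t, w + t, by simpa using hne, by simp [ht, hu], by simp [ht, hw], ?_, ?_, ?_⟩
    · rw [add_right_comm]
      exact mem_image_map_add hue
    · rw [add_right_comm]
      exact mem_image_map_add hwe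
    · rw [add_right_comm u, add_right_comm w]
      rfl

/-- Traces are equivariant under translations parallel to the planes; equality of cardinalities
makes one inclusion sufficient. -/
theorem eq_image_of_lowerTrace {F F' : Finset (Sym2 Site)} (h : lowerTrace k E = F)
    (h' : lowerTrace k (E.image (Sym2.map (· + t))) = F') (hcard : F.card = F'.card) :
    F' = F.image (Sym2.map (· + t)) := by
  refine (Finset.eq_of_subset_of_card_le ?_ ?_).symm
  · intro e he
    obtain ⟨e, he, rfl⟩ := Finset.mem_image.1 he
    rw [← Finset.mem_coe, ← h']
    refine map_mem_lowerTrace ht ?_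
    rwa [h]
  · rw [Finset.card_image_of_injective _ (sym2_map_add_injective t), hcard]

theorem eq_image_of_upperTrace {F F' : Finset (Sym2 Site)} (h : upperTrace k E = F)
    (h' : upperTrace k (E.image (Sym2.map (· + t))) = F') (hcard : F.card = F'.card) :
    F' = F.image (Sym2.map (· + t)) := by
  refine (Finset.eq_of_subset_of_card_le ?_ ?_).symm
  · intro e he
    obtain ⟨e, he, rfl⟩ := Finset.mem_image.1 he
    rw [← Finset.mem_coe, ← h']
    refine map_mem_upperTrace ht ?_
    rwa [h]
  · rw [Finset.card_image_of_injective _ (sym2_map_add_injective t), hcard]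

/-- Were `k < k'`, the edge crossing upwards from level `k` would be counted below `k'` but not
below `k`. -/
theorem level_le {k' : ℤ}
    (h : (edgesBelow k' (E.image (Sym2.map (· + t)))).card = (edgesBelow k E).card)
    (hu : ∃ u : Site, u 0 = k ∧ s(u, u + unitX) ∈ E) : k' ≤ k := by
  rw [card_edgesBelow_image ht] at h
  obtain ⟨u, hu, he⟩ := hu
  by_contra! hlt
  refine h.not_gt (Finset.card_lt_card
    ((Finset.ssubset_iff_of_subset ?_).2 ⟨s(u, u + unitX), ?_, ?_⟩))
  · intro e he
    rw [mem_edgesBelow] at he ⊢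
    exact ⟨he.1, fun v hv => (he.2 v hv).trans hlt.le⟩
  · refine mem_edgesBelow.2 ⟨he, fun v hv => ?_⟩
    rcases Sym2.mem_iff.1 hv with rfl | rfl
    · omega
    · simp; omega
  · intro h
    have := (mem_edgesBelow.1 h).2 _ (Sym2.mem_mk_right _ _)
    simp at this
    omega

end Translation

/-- Conjugating a translation by the exchange of `y` and `z` gives a translation again. -/
theorem exists_image_eq_of_place {F F' : Finset (Sym2 Site)} {b : Bool} {t t' r : Site}
    (h : F'.image (Sym2.map (place b t')) =
      (F.image (Sym2.map (place b t))).image (Sym2.map (· + r)))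
    (ht : t 0 = t' 0) (hr : r 0 = 0) :
    ∃ d : Site, d 0 = 0 ∧ F' = F.image (Sym2.map (· + d)) := by
  refine ⟨place b 0 (t + r - t'), by simp [place_apply_zero, ht, hr], ?_⟩
  apply Finset.image_injective (Sym2.map.injective (place_injective b t'))
  rw [h, Finset.image_image, Finset.image_image, ← Sym2.map_comp, ← Sym2.map_comp]
  congr 2
  funext v
  simp only [Function.comp_apply, place_add, place_zero_involutive b _]
  rw [place_eq b t, place_eq b t']
  abel

theorem exists_injective_concatenation (n₁ n₂ : ℕ) :
    ∃ Φ : PolygonClass n₁ × PolygonClass n₂ → Bool × PolygonClass (n₁ + n₂),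
      Function.Injective Φ ∧ ∀ q, (Φ q).2.1 = q.1.1 + q.2.1 + 1 := by
  choose E hE b t ht hl hu hc hx using fun q : PolygonClass n₁ × PolygonClass n₂ =>
    exists_concatenation q.1.rep_mem q.2.rep_mem
  refine ⟨fun q => (b q, .mk (hE q)), fun q q' h => ?_, fun q => rfl⟩
  obtain ⟨hb, hm⟩ := Prod.mk.inj h
  obtain ⟨y, z, hyz⟩ := PolygonClass.mk_eq_mk_iff.1 hm
  have hyz' : E q = translateYZ (-y) (-z) (E q') := by
    rw [hyz, translateYZ_translateYZ, add_neg_cancel, add_neg_cancel, translateYZ_zero]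
  have r0 : ∀ y z : ℤ, (![0, y, z] : Site) 0 = 0 := fun _ _ => rfl
  -- Both cutting levels have exactly `n₁ - 1` edges below them and an edge crossing upwards, so
  -- neither exceeds the other.
  have hlev : (q.1.1 : ℤ) = q'.1.1 := by
    apply le_antisymm
    · refine level_le (r0 (-y) (-z)) ?_ (hx q')
      rw [hc q', ← hc q]
      exact congrArg (fun E => (edgesBelow _ E).card) hyz'.symm
    · refine level_le (r0 y z) ?_ (hx q)
      rw [hc q, ← hc q']
      exact congrArg (fun E => (edgesBelow _ E).card) hyz.symm
  have hl' := hl q'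
  have hu' := hu q'
  have ht' := ht q'
  rw [← hlev, hyz] at hl' hu'
  rw [← hlev] at ht'
  rw [← hb] at hu'
  have e1 := eq_image_of_lowerTrace (r0 y z) (hl q) hl'
    (q.1.rep_mem.2.1.trans q'.1.rep_mem.2.1.symm)
  have hcard : ∀ (F : Finset (Sym2 Site)) t, (F.image (Sym2.map (place (b q) t))).card = F.card :=
    fun F t => Finset.card_image_of_injective _ (Sym2.map.injective (place_injective _ t))
  have e2 := eq_image_of_upperTrace (r0 y z) (hu q) hu'
    (by rw [hcard, hcard, q.2.rep_mem.2.1, q'.2.rep_mem.2.1])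
  obtain ⟨d, hd, e3⟩ := exists_image_eq_of_place e2 ((ht q).trans ht'.symm) (r0 y z)
  rw [← translateYZ_eq_image hd] at e3
  exact Prod.ext (PolygonClass.eq_of_rep_eq e1) (PolygonClass.eq_of_rep_eq e3)

theorem partitionFunction_mul_le (n₁ n₂ : ℕ) (f : ℝ) :
    partitionFunction n₁ f * partitionFunction n₂ f * Real.exp f ≤
      2 * partitionFunction (n₁ + n₂) f := by
  obtain ⟨Φ, hΦ, hs⟩ := exists_injective_concatenation n₁ n₂
  simp only [partitionFunction_eq_sum]
  calc _ = ∑ q : PolygonClass n₁ × PolygonClass n₂, Real.exp (f * (Φ q).2.1) := by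
        rw [Fintype.sum_mul_sum, Finset.sum_mul, Fintype.sum_prod_type]
        refine Finset.sum_congr rfl fun q _ => ?_
        rw [Finset.sum_mul]
        refine Finset.sum_congr rfl fun q' _ => ?_
        rw [hs, ← Real.exp_add, ← Real.exp_add]
        push_cast
        ring_nf
    _ = ∑ x ∈ Finset.univ.map ⟨Φ, hΦ⟩, Real.exp (f * x.2.1) := by
        rw [Finset.sum_map]
        rfl
    _ ≤ ∑ x : Bool × PolygonClass (n₁ + n₂), Real.exp (f * x.2.1) :=
        Finset.sum_le_sum_of_subset_of_nonneg (Finset.subset_univ _) fun _ _ _ => by positivity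
    _ = _ := by
        rw [Fintype.sum_prod_type, Fintype.sum_bool, two_mul]

/-! ### Polygons of large span and the lower bound -/

theorem mem_halfSpacePolygons_of_walk {n s : ℕ} {v : Site} {c : cubicLattice.Walk v v}
    (hc : c.IsCycle) (hlen : c.length = n) (hnn : ∀ x ∈ c.support, 0 ≤ x 0 ∧ x 0 ≤ s)
    (h0 : ∃ e ∈ c.edges, ∀ x ∈ e, x 0 = 0) (hs : ∃ e ∈ c.edges, ∃ x ∈ e, x 0 = s) :
    c.edges.toFinset ∈ halfSpacePolygons n s := by
  have hocc : ∀ x ∈ occupiedSites c.edges.toFinset, x ∈ c.support := by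
    rintro x ⟨e, he, hx⟩
    exact SimpleGraph.Walk.mem_support_iff_exists_mem_edges.2
      (.inr ⟨e, List.mem_toFinset.1 he, hx⟩)
  refine ⟨⟨v, c, hc, by simp⟩, ?_, fun x hx => (hnn x (hocc x hx)).1, by simpa using h0, ?_, ?_⟩
  · rw [List.toFinset_card_of_nodup hc.isTrail.edges_nodup, SimpleGraph.Walk.length_edges, hlen]
  · obtain ⟨e, he, x, hx, hxs⟩ := hs
    exact ⟨x, ⟨e, List.mem_toFinset.2 he, hx⟩, hxs⟩
  · rintro _ ⟨x, hx, rfl⟩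
    exact (hnn x (hocc x hx)).2

instance : DecidableRel cubicLattice.Adj := fun u v =>
  inferInstanceAs (Decidable (∑ i, |u i - v i| = 1))

theorem nonempty_halfSpacePolygons_four_one : (halfSpacePolygons 4 1).Nonempty := by
  have h1 : cubicLattice.Adj ![0, 0, 0] ![0, 1, 0] := by decide
  have h2 : cubicLattice.Adj ![0, 1, 0] ![1, 1, 0] := by decide
  have h3 : cubicLattice.Adj ![1, 1, 0] ![1, 0, 0] := by decide
  have h4 : cubicLattice.Adj ![1, 0, 0] ![0, 0, 0] := by decide
  refine ⟨_, mem_halfSpacePolygons_of_walk (c := .cons h1 (.cons h2 (.cons h3 (.cons h4 .nil))))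
    ?_ rfl ?_ ⟨s(![0, 0, 0], ![0, 1, 0]), ?_, ?_⟩ ⟨s(![1, 1, 0], ![1, 0, 0]), ?_, ?_⟩⟩
  · simp [SimpleGraph.Walk.cons_isCycle_iff]
  all_goals simp

theorem nonempty_halfSpacePolygons_six_two : (halfSpacePolygons 6 2).Nonempty := by
  have h1 : cubicLattice.Adj ![0, 0, 0] ![0, 1, 0] := by decide
  have h2 : cubicLattice.Adj ![0, 1, 0] ![1, 1, 0] := by decide
  have h3 : cubicLattice.Adj ![1, 1, 0] ![2, 1, 0] := by decide
  have h4 : cubicLattice.Adj ![2, 1, 0] ![2, 0, 0] := by decide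
  have h5 : cubicLattice.Adj ![2, 0, 0] ![1, 0, 0] := by decide
  have h6 : cubicLattice.Adj ![1, 0, 0] ![0, 0, 0] := by decide
  refine ⟨_, mem_halfSpacePolygons_of_walk
    (c := .cons h1 (.cons h2 (.cons h3 (.cons h4 (.cons h5 (.cons h6 .nil))))))
    ?_ rfl ?_ ⟨s(![0, 0, 0], ![0, 1, 0]), ?_, ?_⟩ ⟨s(![2, 1, 0], ![2, 0, 0]), ?_, ?_⟩⟩
  · simp [SimpleGraph.Walk.cons_isCycle_iff]
  all_goals simp

/-- Concatenation with a unit square adds four edges and two to the span, that is, raises `m` by 2;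
hence the two base cases. -/
theorem nonempty_halfSpacePolygons (m : ℕ) :
    (halfSpacePolygons (2 * (m + 2)) (m + 1)).Nonempty := by
  induction m using Nat.twoStepInduction with
  | zero => exact nonempty_halfSpacePolygons_four_one
  | one => exact nonempty_halfSpacePolygons_six_two
  | more m ih _ =>
    obtain ⟨E, hE⟩ := ih
    obtain ⟨E', hE'⟩ := nonempty_halfSpacePolygons_four_one
    obtain ⟨F, hF, -⟩ := exists_concatenation hE hE'
    exact ⟨F, hF⟩

theorem exp_le_partitionFunction {m : ℕ} (hm : 2 ≤ m) (f : ℝ) :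
    Real.exp (f * (m - 1)) ≤ partitionFunction (2 * m) f := by
  obtain ⟨m, rfl⟩ := Nat.exists_eq_add_of_le' hm
  obtain ⟨E, hE⟩ := nonempty_halfSpacePolygons m
  rw [partitionFunction_eq_sum]
  refine le_trans (le_of_eq ?_) (Finset.single_le_sum
    (f := fun q : PolygonClass (2 * (m + 2)) => Real.exp (f * q.1))
    (fun _ _ => by positivity) (Finset.mem_univ (PolygonClass.mk hE)))
  simp only [PolygonClass.mk]
  push_cast
  ring_nf

/-! ### Fekete's lemma and existence of the free energy -/

open Filter Topology in
/-- **Fekete's lemma** for sequences which are subadditive from some index on. -/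
theorem exists_tendsto_div_of_subadditive_from {u : ℕ → ℝ} {N : ℕ} {B : ℝ}
    (hu : ∀ m n, N ≤ m → N ≤ n → u (m + n) ≤ u m + u n) (hB : ∀ n, N ≤ n → B * n ≤ u n) :
    ∃ l, Tendsto (fun n : ℕ => u n / n) atTop (𝓝 l) := by
  -- Starting at `N + 1` excludes `n = 0`, where the quotient would be a default value.
  set S := (fun n : ℕ => u n / n) '' Set.Ici (N + 1) with hS
  have hbdd : BddBelow S := by
    refine ⟨B, ?_⟩
    rintro _ ⟨n, hn, rfl⟩
    have hn : N + 1 ≤ n := hn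
    have : (0 : ℝ) < n := by exact_mod_cast (by omega : 0 < n)
    exact (le_div_iff₀ this).2 (hB n (by omega))
  have hmul : ∀ n, N ≤ n → ∀ r, N ≤ r → ∀ k : ℕ, u (n * k + r) ≤ k * u n + u r := by
    intro n hn r hr k
    induction k with
    | zero => simp
    | succ k ih =>
      have := hu n (n * k + r) hn (by nlinarith [Nat.zero_le (n * k)])
      rw [show n * (k + 1) + r = n + (n * k + r) by ring]
      push_cast
      linarith
  refine ⟨sInf S, tendsto_order.2 ⟨fun l hl => ?_, fun L hL => ?_⟩⟩
  · filter_upwards [eventually_ge_atTop (N + 1)] with n hn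
    exact hl.trans_le (csInf_le hbdd ⟨n, hn, rfl⟩)
  · obtain ⟨_, ⟨n, hn, rfl⟩, hnL⟩ := exists_lt_of_csInf_lt (Set.nonempty_Ici.image _) hL
    have hn : N + 1 ≤ n := hn
    have hn0 : n ≠ 0 := by omega
    have hn' : (n : ℝ) ≠ 0 := by exact_mod_cast hn0
    refine .atTop_of_arithmetic hn0 fun r _ => ?_
    have A : Tendsto (fun k : ℕ => (u n + u (n + r) / k) / (n + ((n + r : ℕ) : ℝ) / k)) atTop
        (𝓝 ((u n + 0) / (n + 0))) :=
      (tendsto_const_nhds.add (tendsto_const_div_atTop_nhds_zero_nat _)).div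
        (tendsto_const_nhds.add (tendsto_const_div_atTop_nhds_zero_nat _)) (by simpa)
    rw [add_zero, add_zero] at A
    -- Shifting `k` by one moves a block `n` into the remainder, so that `n + r ≥ N` and `hmul`
    -- applies.
    rw [← map_add_atTop_eq_nat 1, eventually_map]
    filter_upwards [A.eventually (gt_mem_nhds hnL), eventually_ge_atTop 1] with k hk hk1
    have hk0 : (0 : ℝ) < k := by exact_mod_cast hk1
    have hlt : (u n + u (n + r) / k) / (n + ((n + r : ℕ) : ℝ) / k) =
        (k * u n + u (n + r)) / (n * k + (n + r) : ℕ) := by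
      push_cast
      field_simp
    rw [hlt] at hk
    refine lt_of_le_of_lt ?_ hk
    rw [show n * (k + 1) + r = n * k + (n + r) by ring]
    gcongr
    exact hmul n (by omega) (n + r) (by omega) k

open Filter Topology

theorem partitionFunction_pos {m : ℕ} (hm : 2 ≤ m) (f : ℝ) : 0 < partitionFunction (2 * m) f :=
  (Real.exp_pos _).trans_le (exp_le_partitionFunction hm f)

theorem log_partitionFunction_le {f : ℝ} (hf : 0 ≤ f) {m : ℕ} (hm : 2 ≤ m) :
    Real.log (partitionFunction (2 * m) f) ≤
      Real.log 4 + 2 * m * Real.log (Real.exp (f / 2) + 8) := by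
  have h := Real.log_le_log (partitionFunction_pos hm f) (partitionFunction_le hf (2 * m))
  rw [Real.log_mul (by norm_num) (by positivity), Real.log_pow] at h
  simpa using h

theorem exists_tendsto_log_partitionFunction (f : ℝ) :
    ∃ F : ℝ, Tendsto
      (fun m : ℕ => (1 / ((2 * m : ℕ) : ℝ)) * Real.log (partitionFunction (2 * m) f))
      atTop (𝓝 F) := by
  -- The shift by `f - log 2` absorbs the factors `e^f` and 2. Subadditivity is used only from `m =
  -- 2` on, since there are no polygons with 0 or 2 edges.
  set u : ℕ → ℝ := fun m => -(Real.log (partitionFunction (2 * m) f) + (f - Real.log 2)) with hu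
  set c := Real.log (Real.exp (max f 0 / 2) + 8)
  have hsub : ∀ m n, 2 ≤ m → 2 ≤ n → u (m + n) ≤ u m + u n := by
    intro m n hm hn
    have hm' := partitionFunction_pos hm f
    have hn' := partitionFunction_pos hn f
    have h := Real.log_le_log (by positivity) (partitionFunction_mul_le (2 * m) (2 * n) f)
    rw [← mul_add, Real.log_mul (by positivity) (by positivity),
      Real.log_mul hm'.ne' hn'.ne', Real.log_exp,
      Real.log_mul two_ne_zero (partitionFunction_pos (by omega) f).ne'] at h
    simp only [hu]
    linarith
  have hbdd : ∀ m, 2 ≤ m → -(Real.log 4 + 2 * c + |f|) * m ≤ u m := by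
    intro m hm
    -- The word bound requires a nonnegative force; negative `f` is covered by monotonicity, through
    -- `max f 0`.
    have h := (Real.log_le_log (partitionFunction_pos hm f)
      (partitionFunction_mono (2 * m) (le_max_left f 0))).trans
      (log_partitionFunction_le (le_max_right f 0) hm)
    have h1 : (1 : ℝ) ≤ m := by exact_mod_cast (by omega : 1 ≤ m)
    have h2 : 0 ≤ Real.log 2 := Real.log_nonneg (by norm_num)
    have h4 : 0 ≤ Real.log 4 := Real.log_nonneg (by norm_num)
    have h5 := le_abs_self f
    have h6 := mul_le_mul_of_nonneg_left h1 h4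
    have h7 := mul_le_mul_of_nonneg_left h1 (abs_nonneg f)
    simp only [hu]
    linarith
  obtain ⟨l, hl⟩ := exists_tendsto_div_of_subadditive_from hsub hbdd
  refine ⟨(-l - 0) / 2, ?_⟩
  refine ((hl.neg.sub (tendsto_const_div_atTop_nhds_zero_nat (f - Real.log 2))).div_const 2).congr
    fun m => ?_
  simp only [hu]
  push_cast
  rw [neg_div, neg_neg, ← sub_div, add_sub_cancel_right, one_div, mul_inv]
  ring

/-! ### Bounds on the free energy and the limit of large force -/

theorem half_le_of_tendsto {f F : ℝ} (hF : Tendsto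
    (fun m : ℕ => (1 / ((2 * m : ℕ) : ℝ)) * Real.log (partitionFunction (2 * m) f))
      atTop (𝓝 F)) : f / 2 ≤ F := by
  have h : Tendsto (fun m : ℕ => f / 2 - f / 2 / (m : ℝ)) atTop (𝓝 (f / 2 - 0)) :=
    tendsto_const_nhds.sub (tendsto_const_div_atTop_nhds_zero_nat _)
  rw [sub_zero] at h
  refine le_of_tendsto_of_tendsto h hF ?_
  filter_upwards [eventually_ge_atTop 2] with m hm
  have hm0 : (0 : ℝ) < m := by exact_mod_cast (by omega : 0 < m)
  have h := Real.log_le_log (Real.exp_pos _) (exp_le_partitionFunction hm f)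
  rw [Real.log_exp] at h
  refine le_trans (le_of_eq ?_) (mul_le_mul_of_nonneg_left h (by positivity))
  push_cast
  field_simp

theorem le_log_of_tendsto {f F : ℝ} (hf : 0 ≤ f) (hF : Tendsto
    (fun m : ℕ => (1 / ((2 * m : ℕ) : ℝ)) * Real.log (partitionFunction (2 * m) f))
      atTop (𝓝 F)) : F ≤ Real.log (Real.exp (f / 2) + 8) := by
  have h : Tendsto (fun m : ℕ => Real.log 4 / 2 / (m : ℝ) + Real.log (Real.exp (f / 2) + 8)) atTop
      (𝓝 (0 + Real.log (Real.exp (f / 2) + 8))) :=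
    (tendsto_const_div_atTop_nhds_zero_nat _).add tendsto_const_nhds
  rw [zero_add] at h
  refine le_of_tendsto_of_tendsto hF h ?_
  filter_upwards [eventually_ge_atTop 2] with m hm
  have hm0 : (0 : ℝ) < m := by exact_mod_cast (by omega : 0 < m)
  refine (mul_le_mul_of_nonneg_left (log_partitionFunction_le hf hm) (by positivity)).trans
    (le_of_eq ?_)
  push_cast
  field_simp

theorem tendsto_log_exp_half_add_sub :
    Tendsto (fun f : ℝ => Real.log (Real.exp (f / 2) + 8) - f / 2) atTop (𝓝 0) := by
  have h1 : Tendsto (fun f : ℝ => 1 + 8 * Real.exp (-(f / 2))) atTop (𝓝 (1 + 8 * 0)) :=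
    ((Real.tendsto_exp_neg_atTop_nhds_zero.comp
      (tendsto_id.atTop_div_const two_pos)).const_mul 8).const_add 1
  rw [mul_zero, add_zero] at h1
  have h2 := h1.log one_ne_zero
  rw [Real.log_one] at h2
  refine h2.congr fun f => ?_
  have : Real.exp (f / 2) + 8 = Real.exp (f / 2) * (1 + 8 * Real.exp (-(f / 2))) := by
    rw [Real.exp_neg]
    field_simp
  rw [this, Real.log_mul (by positivity) (by positivity), Real.log_exp]
  ring

theorem mainTheorem3 :
    ∃ F : ℝ → ℝ, IsFreeEnergy F ∧
      Filter.Tendsto (fun f : ℝ => F f - f / 2) Filter.atTop (nhds 0) := by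
  choose F hF using exists_tendsto_log_partitionFunction
  refine ⟨F, hF, ?_⟩
  refine tendsto_of_tendsto_of_tendsto_of_le_of_le' tendsto_const_nhds
    tendsto_log_exp_half_add_sub ?_ ?_
  · filter_upwards with f
    exact sub_nonneg.2 (half_le_of_tendsto (hF f))
  · filter_upwards [eventually_ge_atTop 0] with f hf
    exact sub_le_sub_right (le_log_of_tendsto hf (hF f)) _
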